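/- Let $N\ge 2$ and consider the static, spherically symmetric $\mathfrak{su}(N)$ Einstein--Yang--Mills equations for an event-horizon exterior in the following form. The unknowns are functions of $\tau>0$: the radius $r>0$, $\Psi=\sqrt{\mu}$, the gauge functions $\omega_1,\dots,\omega_{N-1}$ (with $\omega_0\equiv\omega_N\equiv 0$), $U_1,\dots,U_{N-1}$ (with $U_j=\Psi\, d\omega_j/dr$), and $$\kappa=\frac1{2\Psi}\bigl(1+\Psi^2+2\mu G-2r^2p_\theta\bigr),\qquad \mu G=\sum_{j=1}^{N-1}U_j^2,\qquad p_\theta=\frac1{4r^4}\sum_{j=1}^{N}\bigl(\omega_j^2-\omega_{j-1}^2-N-1+2j\bigr)^2,$$ and, with a dot for $d/d\tau$, they satisfy $$\dot r=r\Psi,\quad \dot\omega_j=rU_j,\quad \dot\Psi=(\kappa-\Psi)\Psi-2\mu G,\quad \dot\kappa=-\kappa^2+1+2\mu G,$$ $$\dot U_j=-(\kappa-\Psi)U_j-\frac1r\Bigl[1-\omega_j^2+\tfrac12\bigl(\omega_{j+1}^2+\omega_{j-1}^2\bigr)\Bigr]\omega_j .$$ Suppose that the solution starts at $\tau=0$ from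 a regular non-degenerate event horizon of radius $r_h>0$: as $\tau\to0^+$, $r\to r_h$, $\mu=\Psi^2\to0$, $\mu/(r-r_h)$ tends to a finite limit $\mu'(r_h)>0$, and each $\omega_j$ and each $d\omega_j/dr=U_j/\Psi$ has a finite limit. Suppose further that the solution exists with $\Psi(\tau)>0$ for all $\tau>0$ and that $r(\tau)$ remains bounded. Then $\Psi\to0$ and $\kappa\to1$ as $\tau\to\infty$. Moreover, there is at least one $j\in\{1,\dots,N-1\}$ for which $\omega_j\to0$ as $\tau\to\infty$, and every such $\omega_j$ has infinitely many zeros in $(0,\infty)$ (an identically vanishing $\omega_j$ is included). -/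

import Mathlib

open Filter Topology

namespace SuNEYM

/-- The tangential pressure
`p_θ = (1 / (4 r⁴)) ∑_{j=1}^{N} (ω_j² - ω_{j-1}² - N - 1 + 2 j)²`
as a function of the radius `r` and of the values `w j` of the gauge functions `ω_j`. -/
noncomputable def pTheta (N : ℕ) (r : ℝ) (w : ℕ → ℝ) : ℝ :=
  1 / (4 * r ^ 4) *
    ∑ j ∈ Finset.Icc 1 N, (w j ^ 2 - w (j - 1) ^ 2 - (N : ℝ) - 1 + 2 * (j : ℝ)) ^ 2

/-- The quantity `μ G`, where `G = ∑_{j=1}^{N-1} (dω_j/dr)²`. Since `U_j = √μ dω_j/dr`,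
it equals `∑_{j=1}^{N-1} U_j²`; here `u j` is the value of `U_j`. -/
noncomputable def muG (N : ℕ) (u : ℕ → ℝ) : ℝ :=
  ∑ j ∈ Finset.Ico 1 N, u j ^ 2

/-- The gauge force `[1 - ω_j² + ½ (ω_{j+1}² + ω_{j-1}²)] ω_j`. -/
noncomputable def gaugeForce (w : ℕ → ℝ) (j : ℕ) : ℝ :=
  (1 - w j ^ 2 + (1 / 2) * (w (j + 1) ^ 2 + w (j - 1) ^ 2)) * w j

/-- The regular form of the static, spherically symmetric `su(N)` Einstein-Yang-Mills field
equations, in the independent variable `τ`, on the whole half-line `τ > 0`, with `Ψ = √μ > 0`.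

The gauge functions are `ω 1, …, ω (N - 1)`, with the convention `ω 0 = ω N = 0`;
`U j` is `Ψ dω_j/dr`. The equation for the metric function `S`, which enters none of the other
equations, is not part of the system. -/
structure IsGlobalSolution (N : ℕ) (r Ψ κ : ℝ → ℝ) (ω U : ℕ → ℝ → ℝ) : Prop where
  r_pos : ∀ τ, 0 < τ → 0 < r τ
  Ψ_pos : ∀ τ, 0 < τ → 0 < Ψ τ
  ω_zero : ∀ τ, 0 < τ → ω 0 τ = 0
  ω_last : ∀ τ, 0 < τ → ω N τ = 0
  /-- the definition of `κ` -/
  κ_eq : ∀ τ, 0 < τ →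
    κ τ = 1 / (2 * Ψ τ) *
      (1 + Ψ τ ^ 2 + 2 * muG N (fun j => U j τ)
        - 2 * r τ ^ 2 * pTheta N (r τ) (fun j => ω j τ))
  r_deriv : ∀ τ, 0 < τ → HasDerivAt r (r τ * Ψ τ) τ
  ω_deriv : ∀ j ∈ Finset.Ico 1 N, ∀ τ, 0 < τ → HasDerivAt (ω j) (r τ * U j τ) τ
  Ψ_deriv : ∀ τ, 0 < τ →
    HasDerivAt Ψ ((κ τ - Ψ τ) * Ψ τ - 2 * muG N (fun j => U j τ)) τ
  U_deriv : ∀ j ∈ Finset.Ico 1 N, ∀ τ, 0 < τ →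
    HasDerivAt (U j)
      (-(κ τ - Ψ τ) * U j τ - 1 / r τ * gaugeForce (fun i => ω i τ) j) τ
  κ_deriv : ∀ τ, 0 < τ →
    HasDerivAt κ (-(κ τ) ^ 2 + 1 + 2 * muG N (fun j => U j τ)) τ

/-- The solution starts, at `τ = 0`, from a regular non-degenerate event horizon of radius
`rh > 0`: as `τ → 0⁺`, the radius tends to `rh`, `μ = Ψ²` tends to `0`, the right derivative
`μ'(rh) = lim μ / (r - rh)` exists, is finite and positive, and each `ω_j` and
`dω_j/dr = U_j / Ψ` have finite limits. -/
structure HasRegularHorizon (N : ℕ) (rh : ℝ) (r Ψ : ℝ → ℝ) (ω U : ℕ → ℝ → ℝ) : Prop where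
  rh_pos : 0 < rh
  r_tendsto : Tendsto r (𝓝[>] 0) (𝓝 rh)
  Ψ_tendsto : Tendsto Ψ (𝓝[>] 0) (𝓝 0)
  μ_deriv : ∃ μ' : ℝ, 0 < μ' ∧
    Tendsto (fun τ => Ψ τ ^ 2 / (r τ - rh)) (𝓝[>] 0) (𝓝 μ')
  ω_tendsto : ∀ j ∈ Finset.Ico 1 N, ∃ wh : ℝ, Tendsto (ω j) (𝓝[>] 0) (𝓝 wh)
  ω'_tendsto : ∀ j ∈ Finset.Ico 1 N, ∃ wh' : ℝ,
    Tendsto (fun τ => U j τ / Ψ τ) (𝓝[>] 0) (𝓝 wh')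

end SuNEYM

namespace SuNEYM

open Asymptotics Set

/-! ### Real functions on a half-line -/

/-! The horizon forces `κ → +∞` as `τ → 0⁺`, and `κ' ≥ 1 - κ²` then keeps `κ ≥ 1`. Since `log r` is
increasing and bounded with derivative `Ψ`, adding a large multiple of it to `-Ψ` or `-(κ + Ψ)`
gives monotone bounded functions. So `Ψ` and `κ` converge, and their equations leave only the limits
`0` and `1`.

Integral control of `μG` and the constraint for `p_θ` bound the `ω_j`. Barbalat's lemma, applied to
`Ψ` and then to `r U_j = dω_j/dτ`, shows that `μG` and every gauge force tend to zero, while the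
constraint gives `2 r² p_θ → 1`. If no `ω_j` tended to zero, the brackets in the forces would. These
are half the differences of consecutive fluxes, which sum to zero, so all fluxes and hence `p_θ`
would vanish in the limit, a contradiction.

A decaying `ω_j` asymptotically obeys `ω'' + ω' + cω = 0` with `c ≥ 3/4 > 1/4`, an underdamped
oscillator, so the phase `arctan (ω'/ω)` cannot remain defined forever. -/

theorem monotoneOn_Ici_of_hasDerivAt_nonneg {f f' : ℝ → ℝ} {a : ℝ}
    (hf : ∀ t, a ≤ t → HasDerivAt f (f' t) t) (h0 : ∀ t, a ≤ t → 0 ≤ f' t) :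
    MonotoneOn f (Ici a) := by
  refine monotoneOn_of_hasDerivWithinAt_nonneg (f' := f') (convex_Ici a)
    (fun t ht => (hf t ht).continuousAt.continuousWithinAt) (fun t ht => ?_) fun t ht => ?_
  · exact (hf t (interior_subset ht)).hasDerivWithinAt
  · exact h0 t (interior_subset ht)

theorem le_of_hasDerivAt_neg_of_eq {f f' : ℝ → ℝ} {a B : ℝ}
    (hf : ∀ t, a ≤ t → HasDerivAt f (f' t) t) (ha : f a ≤ B)
    (hB : ∀ t, a ≤ t → f t = B → f' t < 0) : ∀ t, a ≤ t → f t ≤ B := by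
  intro t hat
  refine image_le_of_deriv_right_lt_deriv_boundary (f := f) (f' := f') (a := a) (b := t)
    (B := fun _ => B) (B' := fun _ => 0)
    (fun x hx => (hf x hx.1).continuousAt.continuousWithinAt)
    (fun x hx => (hf x hx.1).hasDerivWithinAt) ha (fun x => hasDerivAt_const x B)
    (fun x hx h => hB x hx.1 h) ⟨hat, le_rfl⟩

theorem exists_tendsto_of_monotoneOn_Ici {f : ℝ → ℝ} {a B : ℝ} (hf : MonotoneOn f (Ici a))
    (hB : ∀ t, a ≤ t → f t ≤ B) : ∃ l, Tendsto f atTop (𝓝 l) := by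
  have hm : Monotone fun t => f (max a t) := fun s t hst =>
    hf (mem_Ici.2 (le_max_left a s)) (mem_Ici.2 (le_max_left a t)) (max_le_max le_rfl hst)
  have hb : BddAbove (range fun t => f (max a t)) := by
    refine ⟨B, ?_⟩
    rintro _ ⟨t, rfl⟩
    exact hB _ (le_max_left _ _)
  refine ⟨_, (tendsto_atTop_ciSup hm hb).congr' ?_⟩
  filter_upwards [eventually_ge_atTop a] with t ht
  rw [max_eq_right ht]

/-- A form of Barbalat's lemma. -/
theorem tendsto_zero_of_hasDerivAt_add {f φ ψ ψ' : ℝ → ℝ} {l : ℝ}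
    (hfl : Tendsto f atTop (𝓝 l)) (hf : ∀ᶠ t in atTop, HasDerivAt f (φ t + ψ t) t)
    (hφ : Tendsto φ atTop (𝓝 0)) (hψ : ∀ᶠ t in atTop, HasDerivAt ψ (ψ' t) t)
    (hψ' : ψ' =O[atTop] (1 : ℝ → ℝ)) : Tendsto ψ atTop (𝓝 0) := by
  obtain ⟨K, hK, hb⟩ := hψ'.exists_pos
  rw [Metric.tendsto_atTop]
  intro ε hε
  -- On a window of this length `ψ` varies by at most `ε/4`.
  set h : ℝ := ε / (4 * K) with hh
  have hpos : 0 < h := by positivity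
  have hdiff : Tendsto (fun t => f (t + h) - f t) atTop (𝓝 0) := by
    simpa using (hfl.comp (tendsto_atTop_add_const_right _ h tendsto_id)).sub hfl
  have h1 : ∀ᶠ t in atTop, |f (t + h) - f t| < h * (ε / 4) := by
    have := (Metric.tendsto_nhds.1 hdiff) (h * (ε / 4)) (by positivity)
    simpa [Real.dist_eq] using this
  have h2 : ∀ᶠ t in atTop, |φ t| < ε / 4 := by
    have := (Metric.tendsto_nhds.1 hφ) (ε / 4) (by positivity)
    simpa [Real.dist_eq] using this
  obtain ⟨T, hT⟩ := eventually_atTop.1 (hf.and (hψ.and (hb.bound.and (h1.and h2))))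
  refine ⟨T, fun t ht => ?_⟩
  obtain ⟨ξ, hξ, hslope⟩ := exists_hasDerivAt_eq_slope f (fun t => φ t + ψ t)
    (show t < t + h by linarith)
    (fun x hx => (hT x (ht.trans hx.1)).1.continuousAt.continuousWithinAt)
    (fun x hx => (hT x (ht.trans hx.1.le)).1)
  have hsum : |φ ξ + ψ ξ| < ε / 4 := by
    rw [hslope, add_sub_cancel_left, abs_div, abs_of_pos hpos, div_lt_iff₀ hpos, mul_comm]
    exact (hT t ht).2.2.2.1
  have hφξ := (hT ξ (ht.trans hξ.1.le)).2.2.2.2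
  have hlip : ‖ψ ξ - ψ t‖ ≤ K * ‖ξ - t‖ := by
    refine (convex_Ici T).norm_image_sub_le_of_norm_hasDerivWithin_le (f' := ψ')
      (fun x hx => (hT x hx).2.1.hasDerivWithinAt) (fun x hx => ?_) ht (ht.trans hξ.1.le)
    simpa using (hT x hx).2.2.1
  have hlip' : |ψ ξ - ψ t| ≤ ε / 4 := by
    refine hlip.trans ?_
    rw [Real.norm_eq_abs, abs_of_pos (sub_pos.2 hξ.1)]
    calc K * (ξ - t) ≤ K * h := by gcongr; linarith [hξ.2]
      _ = ε / 4 := by rw [hh]; field_simp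
  rw [Real.dist_eq, sub_zero]
  rw [abs_lt] at *
  rw [abs_le] at hlip'
  constructor <;> linarith

theorem eq_zero_of_tendsto_of_hasDerivAt {f f' : ℝ → ℝ} {l m : ℝ}
    (hfl : Tendsto f atTop (𝓝 l)) (hf : ∀ᶠ t in atTop, HasDerivAt f (f' t) t)
    (hf' : Tendsto f' atTop (𝓝 m)) : m = 0 := by
  have : Tendsto (fun _ : ℝ => m) atTop (𝓝 0) := by
    refine tendsto_zero_of_hasDerivAt_add (φ := fun t => f' t - m) (ψ' := fun _ => 0) hfl ?_ ?_
      (Eventually.of_forall fun t => hasDerivAt_const t m) (isBigO_zero _ _)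
    · simpa using hf
    · simpa using hf'.sub_const m
  exact tendsto_nhds_unique tendsto_const_nhds this

/-- Where `|y| = M ≥ 2K + 1`, damping beats forcing: `(y²)' ≤ -M² + 2MK < 0`, so `y²` cannot cross
`M²`. -/
theorem isBigO_one_of_damped {y c f : ℝ → ℝ}
    (hy : ∀ᶠ t in atTop, HasDerivAt y (-c t * y t + f t) t)
    (hc : ∀ᶠ t in atTop, 1 / 2 ≤ c t) (hf : f =O[atTop] (1 : ℝ → ℝ)) :
    y =O[atTop] (1 : ℝ → ℝ) := by
  obtain ⟨K, hK, hb⟩ := hf.exists_pos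
  obtain ⟨T, hT⟩ := eventually_atTop.1 (hy.and (hc.and hb.bound))
  set M := max |y T| (2 * K + 1) with hM
  have hM1 : 2 * K + 1 ≤ M := le_max_right _ _
  have hbound : ∀ t, T ≤ t → y t ^ 2 ≤ M ^ 2 := by
    refine le_of_hasDerivAt_neg_of_eq (fun t ht => (hT t ht).1.pow 2) ?_ ?_
    · rw [← sq_abs]
      exact pow_le_pow_left₀ (abs_nonneg _) (le_max_left _ _) 2
    · intro t ht h
      have habs : |y t| = M := by
        rw [← sq_abs] at h
        exact (pow_left_inj₀ (abs_nonneg _) (by linarith) two_ne_zero).1 h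
      have hft : |f t| ≤ K := by simpa using (hT t ht).2.2
      have h1 : y t * f t ≤ M * K := by
        calc y t * f t ≤ |y t * f t| := le_abs_self _
          _ = M * |f t| := by rw [abs_mul, habs]
          _ ≤ M * K := by gcongr
      have h2 : 1 / 2 * M ^ 2 ≤ c t * M ^ 2 := by gcongr; exact (hT t ht).2.1
      have h3 : M * (2 * K + 1) ≤ M * M := by gcongr
      have h4 : c t * y t ^ 2 = c t * M ^ 2 := by rw [h]
      simp only [Nat.cast_ofNat, Nat.add_one_sub_one, pow_one]
      nlinarith
  refine IsBigO.of_bound M ?_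
  filter_upwards [eventually_ge_atTop T] with t ht
  simpa using abs_le_of_sq_le_sq (hbound t ht) (by linarith)

theorem zeros_infinite_of_frequently {f : ℝ → ℝ} (h : ∀ T, 0 < T → ∃ t, T ≤ t ∧ f t = 0) :
    {t : ℝ | 0 < t ∧ f t = 0}.Infinite := by
  intro hfin
  obtain ⟨B, hB⟩ := hfin.bddAbove
  obtain ⟨t, ht, h0⟩ := h (max B 0 + 1) (by positivity)
  have h1 := hB ⟨by linarith [le_max_right B 0], h0⟩
  linarith [le_max_left B 0]

variable {N : ℕ} {rh : ℝ} {r Ψ κ : ℝ → ℝ} {ω U : ℕ → ℝ → ℝ}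

theorem muG_nonneg (N : ℕ) (u : ℕ → ℝ) : 0 ≤ muG N u :=
  Finset.sum_nonneg fun _ _ => sq_nonneg _

theorem sq_le_muG {u : ℕ → ℝ} {j : ℕ} (hj : j ∈ Finset.Ico 1 N) : u j ^ 2 ≤ muG N u :=
  Finset.single_le_sum (f := fun j => u j ^ 2) (fun _ _ => sq_nonneg _) hj

/-! ### Behaviour at the horizon -/

namespace IsGlobalSolution

theorem two_mul_Ψ_mul_κ (h : IsGlobalSolution N r Ψ κ ω U) {τ : ℝ} (hτ : 0 < τ) :
    2 * (Ψ τ * κ τ) = 1 + Ψ τ ^ 2 + 2 * muG N (fun j => U j τ)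
        - 2 * r τ ^ 2 * pTheta N (r τ) (fun j => ω j τ) := by
  have := (h.Ψ_pos τ hτ).ne'
  rw [h.κ_eq τ hτ]
  field_simp

theorem exists_tendsto_ω_horizon (h : IsGlobalSolution N r Ψ κ ω U)
    (hhor : HasRegularHorizon N rh r Ψ ω U) {j : ℕ} (hj : j ≤ N) :
    ∃ wh, Tendsto (ω j) (𝓝[>] 0) (𝓝 wh) := by
  rcases Nat.eq_zero_or_pos j with rfl | h0
  · refine ⟨0, tendsto_const_nhds.congr' ?_⟩
    filter_upwards [self_mem_nhdsWithin] with τ hτ using (h.ω_zero τ hτ).symm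
  rcases hj.eq_or_lt with rfl | hlt
  · refine ⟨0, tendsto_const_nhds.congr' ?_⟩
    filter_upwards [self_mem_nhdsWithin] with τ hτ using (h.ω_last τ hτ).symm
  · exact hhor.ω_tendsto j (Finset.mem_Ico.2 ⟨h0, hlt⟩)

theorem tendsto_muG_horizon (hhor : HasRegularHorizon N rh r Ψ ω U)
    (h : IsGlobalSolution N r Ψ κ ω U) :
    Tendsto (fun τ => muG N (fun j => U j τ)) (𝓝[>] 0) (𝓝 0) := by
  have : Tendsto (fun τ => muG N (fun j => U j τ)) (𝓝[>] 0)
      (𝓝 (∑ j ∈ Finset.Ico 1 N, (0 : ℝ) ^ 2)) := by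
    refine tendsto_finsetSum _ fun j hj => Tendsto.pow ?_ 2
    obtain ⟨w, hw⟩ := hhor.ω'_tendsto j hj
    have h1 := hw.mul hhor.Ψ_tendsto
    rw [mul_zero] at h1
    refine h1.congr' ?_
    filter_upwards [self_mem_nhdsWithin] with τ hτ
    exact div_mul_cancel₀ _ (h.Ψ_pos τ hτ).ne'
  simpa using this

theorem exists_tendsto_pTheta_horizon (h : IsGlobalSolution N r Ψ κ ω U)
    (hhor : HasRegularHorizon N rh r Ψ ω U) :
    ∃ P, Tendsto (fun τ => pTheta N (r τ) (fun j => ω j τ)) (𝓝[>] 0) (𝓝 P) := by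
  choose! w hw using fun j (hj : j ≤ N) => h.exists_tendsto_ω_horizon hhor hj
  refine ⟨pTheta N rh w, ?_⟩
  refine Tendsto.mul ?_ (tendsto_finsetSum _ fun j hj => ?_)
  · refine tendsto_const_nhds.div ((hhor.r_tendsto.pow 4).const_mul 4) ?_
    have := hhor.rh_pos
    positivity
  · have hjN := (Finset.mem_Icc.1 hj).2
    exact ((((((hw j hjN).pow 2).sub ((hw (j - 1) (by omega)).pow 2)).sub_const _).sub_const
      _).add_const _).pow 2

/-- The constraint gives `Ψκ` a finite limit `L`. L'Hôpital's rule identifies `μ'(rh)` with `2L/rh`,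
so non-degeneracy means `L > 0`, and `Ψ → 0⁺` does the rest. -/
theorem tendsto_κ_horizon (h : IsGlobalSolution N r Ψ κ ω U)
    (hhor : HasRegularHorizon N rh r Ψ ω U) : Tendsto κ (𝓝[>] 0) atTop := by
  obtain ⟨P, hP⟩ := h.exists_tendsto_pTheta_horizon hhor
  obtain ⟨m, hm, hμ⟩ := hhor.μ_deriv
  have hg := h.tendsto_muG_horizon hhor
  have hrh := hhor.rh_pos
  have hpos : ∀ᶠ τ in 𝓝[>] (0 : ℝ), 0 < τ := self_mem_nhdsWithin
  obtain ⟨L, hL⟩ : ∃ L, Tendsto (fun τ => Ψ τ * κ τ) (𝓝[>] 0) (𝓝 L) := by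
    refine ⟨_, Tendsto.congr' ?_ (((((hhor.Ψ_tendsto.pow 2).const_add 1).add
      (hg.const_mul 2)).sub (((hhor.r_tendsto.pow 2).const_mul 2).mul hP)).const_mul (1 / 2))⟩
    filter_upwards [hpos] with τ hτ
    rw [← h.two_mul_Ψ_mul_κ hτ]
    ring
  have hΨ' : Tendsto (fun τ => (κ τ - Ψ τ) * Ψ τ - 2 * muG N (fun j => U j τ)) (𝓝[>] 0)
      (𝓝 L) := by
    have := (hL.sub (hhor.Ψ_tendsto.pow 2)).sub (hg.const_mul 2)
    simp only [ne_eq, OfNat.ofNat_ne_zero, not_false_eq_true, zero_pow, sub_zero, mul_zero] at this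
    refine this.congr fun τ => ?_
    ring
  have hlim : Tendsto (fun τ => Ψ τ ^ 2 / (r τ - rh)) (𝓝[>] 0) (𝓝 (2 * L / rh)) := by
    refine HasDerivAt.lhopital_zero_nhdsGT
      (f' := fun τ => 2 * Ψ τ * ((κ τ - Ψ τ) * Ψ τ - 2 * muG N (fun j => U j τ)))
      (g' := fun τ => r τ * Ψ τ) ?_ ?_ ?_ ?_ ?_ ?_
    · filter_upwards [hpos] with τ hτ
      exact ((h.Ψ_deriv τ hτ).pow 2).congr_deriv (by simp)
    · filter_upwards [hpos] with τ hτ using (h.r_deriv τ hτ).sub_const rh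
    · filter_upwards [hpos] with τ hτ using (mul_pos (h.r_pos τ hτ) (h.Ψ_pos τ hτ)).ne'
    · simpa using hhor.Ψ_tendsto.pow 2
    · simpa using hhor.r_tendsto.sub_const rh
    · refine ((hΨ'.const_mul 2).div hhor.r_tendsto hrh.ne').congr' ?_
      filter_upwards [hpos] with τ hτ
      have := (h.r_pos τ hτ).ne'
      have := (h.Ψ_pos τ hτ).ne'
      simp only [Pi.div_apply]
      field_simp
  have hLm := tendsto_nhds_unique hμ hlim
  have hL0 : 0 < L := by
    have : L = m * rh / 2 := by rw [hLm]; field_simp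
    rw [this]; positivity
  have hinv : Tendsto (fun τ => (Ψ τ)⁻¹) (𝓝[>] 0) atTop := by
    refine tendsto_inv_nhdsGT_zero.comp (tendsto_nhdsWithin_iff.2 ⟨hhor.Ψ_tendsto, ?_⟩)
    filter_upwards [hpos] with τ hτ using h.Ψ_pos τ hτ
  refine (hL.pos_mul_atTop hL0 hinv).congr' ?_
  filter_upwards [hpos] with τ hτ
  have := (h.Ψ_pos τ hτ).ne'
  field_simp

theorem exists_one_le_κ (h : IsGlobalSolution N r Ψ κ ω U)
    (hhor : HasRegularHorizon N rh r Ψ ω U) : ∃ T, 0 < T ∧ ∀ τ, T ≤ τ → 1 ≤ κ τ := by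
  obtain ⟨T, hT1, hT⟩ := (((h.tendsto_κ_horizon hhor).eventually_ge_atTop 1).and
    self_mem_nhdsWithin).exists
  refine ⟨T, hT, fun τ hτ => le_of_forall_pos_le_add fun ε hε => ?_⟩
  have hδ : 0 < min ε 1 := by positivity
  have hδ1 : min ε 1 ≤ 1 := min_le_right _ _
  -- At level `1` itself `κ'` may vanish, so the barrier is placed slightly below; the `min` keeps
  -- the level nonnegative, so its square is below `1`.
  have := le_of_hasDerivAt_neg_of_eq (f := fun t => -κ t) (a := T) (B := -(1 - min ε 1))
    (fun t ht => (h.κ_deriv t (hT.trans_le ht)).neg) (by linarith) (fun t ht he => by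
      have he' : κ t = 1 - min ε 1 := by linarith
      have := muG_nonneg N (fun j => U j t)
      rw [he']
      nlinarith) τ hτ
  linarith [min_le_left ε 1]

/-! ### Limits of `Ψ` and `κ` -/

/-- The `μG` terms cancel in the sum: `(κ + Ψ)' = 1 - (κ + Ψ)²/4 - 3(κ - Ψ)²/4`, which is negative
at any level `≥ 3`. -/
theorem exists_add_le (h : IsGlobalSolution N r Ψ κ ω U) {T : ℝ} (hT : 0 < T) :
    ∃ C, ∀ τ, T ≤ τ → κ τ + Ψ τ ≤ C := by
  refine ⟨max (κ T + Ψ T) 3, le_of_hasDerivAt_neg_of_eq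
    (fun t ht => (h.κ_deriv t (hT.trans_le ht)).add (h.Ψ_deriv t (hT.trans_le ht)))
    (le_max_left _ _) fun t ht he => ?_⟩
  have h3 : 3 ≤ κ t + Ψ t := by
    have : κ t + Ψ t = max (κ T + Ψ T) 3 := he
    rw [this]; exact le_max_right _ _
  nlinarith [sq_nonneg (κ t - Ψ t)]

theorem hasDerivAt_log_r (h : IsGlobalSolution N r Ψ κ ω U) {τ : ℝ} (hτ : 0 < τ) :
    HasDerivAt (fun t => Real.log (r t)) (Ψ τ) τ := by
  have := (h.r_pos τ hτ).ne'
  convert (h.r_deriv τ hτ).log this using 1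
  field_simp

theorem r_le_r (h : IsGlobalSolution N r Ψ κ ω U) {s t : ℝ} (hs : 0 < s) (hst : s ≤ t) :
    r s ≤ r t :=
  monotoneOn_Ici_of_hasDerivAt_nonneg (a := s) (fun x hx => h.r_deriv x (hs.trans_le hx))
    (fun x hx => (mul_pos (h.r_pos x (hs.trans_le hx)) (h.Ψ_pos x (hs.trans_le hx))).le)
    (mem_Ici.2 le_rfl) (mem_Ici.2 hst) hst

theorem exists_tendsto_r (h : IsGlobalSolution N r Ψ κ ω U)
    (hbdd : ∃ R : ℝ, ∀ τ : ℝ, 0 < τ → r τ ≤ R) :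
    ∃ ρ, 0 < ρ ∧ Tendsto r atTop (𝓝 ρ) := by
  obtain ⟨R, hR⟩ := hbdd
  obtain ⟨ρ, hρ⟩ := exists_tendsto_of_monotoneOn_Ici (f := r) (a := 1) (B := R)
    (fun s hs t _ hst => h.r_le_r (one_pos.trans_le hs) hst)
    fun t ht => hR t (one_pos.trans_le ht)
  refine ⟨ρ, (h.r_pos 1 one_pos).trans_le (ge_of_tendsto hρ ?_), hρ⟩
  filter_upwards [eventually_ge_atTop 1] with t ht using h.r_le_r one_pos ht

/-- `C log r - Ψ` controls the integral of `2 μ G` as soon as `κ ≤ C`. -/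
theorem hasDerivAt_log_r_sub_Ψ (h : IsGlobalSolution N r Ψ κ ω U) (C : ℝ) {τ : ℝ} (hτ : 0 < τ) :
    HasDerivAt (fun t => C * Real.log (r t) - Ψ t)
      ((C - κ τ + Ψ τ) * Ψ τ + 2 * muG N (fun j => U j τ)) τ := by
  exact (((h.hasDerivAt_log_r hτ).const_mul C).sub (h.Ψ_deriv τ hτ)).congr_deriv (by ring)

theorem tendsto_Ψ (h : IsGlobalSolution N r Ψ κ ω U)
    (hhor : HasRegularHorizon N rh r Ψ ω U) (hbdd : ∃ R : ℝ, ∀ τ : ℝ, 0 < τ → r τ ≤ R) :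
    Tendsto Ψ atTop (𝓝 0) := by
  obtain ⟨T, hT, hκ⟩ := h.exists_one_le_κ hhor
  obtain ⟨C, hC⟩ := h.exists_add_le hT
  have hC0 : 0 ≤ C := by linarith [hC T le_rfl, hκ T le_rfl, h.Ψ_pos T hT]
  obtain ⟨R, hR⟩ := id hbdd
  obtain ⟨ρ, hρ, hr⟩ := h.exists_tendsto_r hbdd
  obtain ⟨q, hq⟩ := exists_tendsto_of_monotoneOn_Ici
    (f := fun t => C * Real.log (r t) - Ψ t) (a := T) (B := C * Real.log R)
    (monotoneOn_Ici_of_hasDerivAt_nonneg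
      (fun t ht => h.hasDerivAt_log_r_sub_Ψ C (hT.trans_le ht)) fun t ht => by
        have h1 := muG_nonneg N (fun j => U j t)
        have h2 := h.Ψ_pos t (hT.trans_le ht)
        have h3 : 0 ≤ (C - κ t + Ψ t) * Ψ t :=
          mul_nonneg (by linarith [hC t ht]) h2.le
        linarith)
    fun t ht => by
      have h1 := Real.log_le_log (h.r_pos t (hT.trans_le ht)) (hR t (hT.trans_le ht))
      have h2 := h.Ψ_pos t (hT.trans_le ht)
      have := mul_le_mul_of_nonneg_left h1 hC0
      linarith
  have hlog := hr.log hρ.ne'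
  have hΨ : Tendsto Ψ atTop (𝓝 (C * Real.log ρ - q)) :=
    ((hlog.const_mul C).sub hq).congr fun t => by ring
  have h0 := eq_zero_of_tendsto_of_hasDerivAt hlog
    ((eventually_gt_atTop 0).mono fun t ht => h.hasDerivAt_log_r ht) hΨ
  rwa [h0] at hΨ

theorem tendsto_κ (h : IsGlobalSolution N r Ψ κ ω U)
    (hhor : HasRegularHorizon N rh r Ψ ω U) (hbdd : ∃ R : ℝ, ∀ τ : ℝ, 0 < τ → r τ ≤ R) :
    Tendsto κ atTop (𝓝 1) := by
  obtain ⟨T, hT, hκ⟩ := h.exists_one_le_κ hhor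
  obtain ⟨C, hC⟩ := h.exists_add_le hT
  obtain ⟨ρ, hρ, hr⟩ := h.exists_tendsto_r hbdd
  have hlog := hr.log hρ.ne'
  have hΨ := h.tendsto_Ψ hhor hbdd
  have hC0 : 0 ≤ C := by linarith [hC T le_rfl, hκ T le_rfl, h.Ψ_pos T hT]
  have hd : ∀ t, 0 < t → HasDerivAt (fun t => κ t + Ψ t) (1 - κ t ^ 2 + (κ t - Ψ t) * Ψ t) t := by
    exact fun t ht => ((h.κ_deriv t ht).add (h.Ψ_deriv t ht)).congr_deriv (by ring)
  obtain ⟨R, hR⟩ := id hbdd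
  obtain ⟨q, hq⟩ := exists_tendsto_of_monotoneOn_Ici
    (f := fun t => C * Real.log (r t) - (κ t + Ψ t)) (a := T) (B := C * Real.log R)
    (monotoneOn_Ici_of_hasDerivAt_nonneg
      (fun t ht => ((h.hasDerivAt_log_r (hT.trans_le ht)).const_mul C).sub
        (hd t (hT.trans_le ht))) fun t ht => by
        have h1 := hκ t ht
        have h2 := h.Ψ_pos t (hT.trans_le ht)
        have h3 : 0 ≤ (C - κ t + Ψ t) * Ψ t :=
          mul_nonneg (by linarith [hC t ht]) h2.le
        nlinarith)
    fun t ht => by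
      have h1 := Real.log_le_log (h.r_pos t (hT.trans_le ht)) (hR t (hT.trans_le ht))
      have h2 := h.Ψ_pos t (hT.trans_le ht)
      have := mul_le_mul_of_nonneg_left h1 hC0
      linarith [hκ t ht]
  have hκl : Tendsto κ atTop (𝓝 (C * Real.log ρ - q)) := by
    have := ((hlog.const_mul C).sub hq).sub hΨ
    rw [sub_zero] at this
    exact this.congr fun t => by ring
  set K := C * Real.log ρ - q
  have hK : 1 ≤ K := ge_of_tendsto hκl ((eventually_ge_atTop T).mono hκ)
  have h0 := eq_zero_of_tendsto_of_hasDerivAt (hκl.add hΨ)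
    ((eventually_gt_atTop 0).mono hd)
    (((hκl.pow 2).const_sub 1).add ((hκl.sub hΨ).mul hΨ))
  -- The limit equation is `1 - K² = 0`; `K ≥ 1` excludes the root `-1`.
  have : K = 1 := by nlinarith
  rwa [this] at hκl

end IsGlobalSolution

/-! ### Boundedness of the gauge functions -/

theorem isBigO_one_mul {l : Filter ℝ} {f g : ℝ → ℝ} (hf : f =O[l] (1 : ℝ → ℝ))
    (hg : g =O[l] (1 : ℝ → ℝ)) : (fun t => f t * g t) =O[l] (1 : ℝ → ℝ) := by
  have := hf.mul hg
  simp only [Pi.one_apply, mul_one] at this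
  exact this

/-- A bound on `p_θ` bounds the gauge functions. -/
theorem sq_le_of_sum_le {w : ℕ → ℝ} {A : ℝ} (h0 : w 0 = 0)
    (hA : ∑ j ∈ Finset.Icc 1 N, (w j ^ 2 - w (j - 1) ^ 2 - (N : ℝ) - 1 + 2 * (j : ℝ)) ^ 2 ≤ A)
    {j : ℕ} (hj : j ≤ N) : w j ^ 2 ≤ j * (A + N + 2) := by
  induction j with
  | zero => simp [h0]
  | succ k ih =>
    have h1 := (Finset.single_le_sum
      (f := fun j : ℕ => (w j ^ 2 - w (j - 1) ^ 2 - (N : ℝ) - 1 + 2 * (j : ℝ)) ^ 2)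
      (fun _ _ => sq_nonneg _) (Finset.mem_Icc.2 ⟨Nat.le_add_left 1 k, hj⟩)).trans hA
    have h2 := ih (by omega)
    simp only [Nat.add_sub_cancel] at h1
    push_cast at h1 ⊢
    have hk : (0 : ℝ) ≤ k := k.cast_nonneg
    nlinarith [sq_nonneg (w (k + 1) ^ 2 - w k ^ 2 - (N : ℝ) - 1 + 2 * ((k : ℝ) + 1) - 1)]

theorem sum_eq_mul_pTheta {ρ : ℝ} (hρ : 0 < ρ) (w : ℕ → ℝ) :
    ∑ j ∈ Finset.Icc 1 N, (w j ^ 2 - w (j - 1) ^ 2 - (N : ℝ) - 1 + 2 * (j : ℝ)) ^ 2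
      = 2 * ρ ^ 2 * (2 * ρ ^ 2 * pTheta N ρ w) := by
  unfold pTheta
  field_simp
  ring

namespace IsGlobalSolution

/-- With `r U_j = dω_j/dτ`, this is a damped second-order equation for `ω_j` from which the radius
drops out. -/
theorem hasDerivAt_r_mul_U (h : IsGlobalSolution N r Ψ κ ω U) {j : ℕ} (hj : j ∈ Finset.Ico 1 N)
    {τ : ℝ} (hτ : 0 < τ) :
    HasDerivAt (fun t => r t * U j t)
      (-(κ τ - 2 * Ψ τ) * (r τ * U j τ) + -gaugeForce (fun i => ω i τ) j) τ := by
  have := (h.r_pos τ hτ).ne'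
  refine ((h.r_deriv τ hτ).mul (h.U_deriv j hj τ hτ)).congr_deriv ?_
  field_simp
  ring

/-- `Q = C log r - Ψ` converges and `Q' ≥ 2μG`, so each late unit interval contains a point where
`μG` is small. There the constraint bounds `p_θ`, hence `ω_j`; the integral bound on `|r U_j|`
carries this to the whole interval. -/
theorem isBigO_ω (h : IsGlobalSolution N r Ψ κ ω U)
    (hhor : HasRegularHorizon N rh r Ψ ω U) (hbdd : ∃ R : ℝ, ∀ τ : ℝ, 0 < τ → r τ ≤ R)
    {j : ℕ} (hj : j ≤ N) : ω j =O[atTop] (1 : ℝ → ℝ) := by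
  obtain ⟨T, hT, hκ⟩ := h.exists_one_le_κ hhor
  obtain ⟨C, hC⟩ := h.exists_add_le hT
  obtain ⟨ρ, hρ, hr⟩ := h.exists_tendsto_r hbdd
  have hΨ := h.tendsto_Ψ hhor hbdd
  obtain ⟨R, hR⟩ := id hbdd
  set Q : ℝ → ℝ := fun t => C * Real.log (r t) - Ψ t with hQdef
  have hQ : Tendsto Q atTop (𝓝 (C * Real.log ρ - 0)) := ((hr.log hρ.ne').const_mul C).sub hΨ
  have hQ1 := (Metric.tendsto_nhds.1 hQ) (1 / 2) (by norm_num)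
  have hQd : ∀ t, T ≤ t → HasDerivAt Q _ t := fun t ht =>
    h.hasDerivAt_log_r_sub_Ψ C (hT.trans_le ht)
  have hQ' : ∀ t, T ≤ t → 2 * muG N (fun j => U j t)
      ≤ (C - κ t + Ψ t) * Ψ t + 2 * muG N (fun j => U j t) := fun t ht => by
    have h2 := h.Ψ_pos t (hT.trans_le ht)
    have h3 : 0 ≤ (C - κ t + Ψ t) * Ψ t := mul_nonneg (by linarith [hC t ht]) h2.le
    linarith
  have hR0 : 0 < R := (h.r_pos T hT).trans_le (hR T hT)
  rcases Nat.eq_zero_or_pos j with rfl | hj0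
  · refine (isBigO_zero (E' := ℝ) _ _).congr' ?_ EventuallyEq.rfl
    filter_upwards [eventually_gt_atTop 0] with t ht using (h.ω_zero t ht).symm
  rcases hj.eq_or_lt with rfl | hjN
  · refine (isBigO_zero (E' := ℝ) _ _).congr' ?_ EventuallyEq.rfl
    filter_upwards [eventually_gt_atTop 0] with t ht using (h.ω_last t ht).symm
  have hmem : j ∈ Finset.Ico 1 N := Finset.mem_Ico.2 ⟨hj0, hjN⟩
  have hrU : ∀ t, T ≤ t → |r t * U j t|
      ≤ R * (1 + ((C - κ t + Ψ t) * Ψ t + 2 * muG N (fun j => U j t)) / 2) := fun t ht => by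
    have h1 := hQ' t ht
    have h2 : U j t ^ 2 ≤ muG N (fun j => U j t) := sq_le_muG (u := fun j => U j t) hmem
    have h3 := h.r_pos t (hT.trans_le ht)
    rw [abs_mul, abs_of_pos h3]
    refine mul_le_mul (hR t (hT.trans_le ht)) ?_ (abs_nonneg _) hR0.le
    rw [← sq_abs] at h2
    nlinarith [sq_nonneg (|U j t| - 1)]
  have hRQ : ∀ t, T ≤ t → HasDerivAt (fun t => R * (t + Q t / 2)) _ t := fun t ht =>
    (((hasDerivAt_id t).add ((hQd t ht).div_const 2)).const_mul R)
  have hm1 := monotoneOn_Ici_of_hasDerivAt_nonneg (a := T)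
    (fun t ht => (hRQ t ht).add (h.ω_deriv j hmem t (hT.trans_le ht))) fun t ht => by
      have := (abs_le.1 (hrU t ht)).1
      linarith
  have hm2 := monotoneOn_Ici_of_hasDerivAt_nonneg (a := T)
    (fun t ht => (hRQ t ht).sub (h.ω_deriv j hmem t (hT.trans_le ht))) fun t ht => by
      have := (abs_le.1 (hrU t ht)).2
      linarith
  set B : ℝ := j * (2 * R ^ 2 * 3 + N + 2) with hB
  refine IsBigO.of_bound (B + 1 + 2 * R) ?_
  have hΨ1 : ∀ᶠ t in atTop, Ψ t ≤ 1 := hΨ.eventually_le_const one_pos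
  obtain ⟨S, hS⟩ := eventually_atTop.1 (hQ1.and (hΨ1.and (eventually_ge_atTop T)))
  filter_upwards [eventually_ge_atTop S] with t ht
  have hTt := (hS t ht).2.2
  obtain ⟨ξ, hξ, hslope⟩ := exists_hasDerivAt_eq_slope Q
    (fun t => (C - κ t + Ψ t) * Ψ t + 2 * muG N (fun j => U j t)) (show t < t + 1 by linarith)
    (fun x hx => (hQd x (hTt.trans hx.1)).continuousAt.continuousWithinAt)
    (fun x hx => hQd x (hTt.trans hx.1.le))
  have hTξ : T ≤ ξ := hTt.trans hξ.1.le
  have hSξ : S ≤ ξ := ht.trans hξ.1.le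
  have hξ0 : 0 < ξ := hT.trans_le hTξ
  have hdQ : ∀ s, S ≤ s → |Q s - Q t| ≤ 1 := fun s hs => by
    have h1 := (hS s hs).1
    have h2 := (hS t ht).1
    rw [Real.dist_eq, abs_lt] at h1 h2
    rw [abs_le]
    constructor <;> linarith [h1.1, h1.2, h2.1, h2.2]
  have hg : 2 * muG N (fun j => U j ξ) ≤ 1 := by
    have h1 := (abs_le.1 (hdQ (t + 1) (by linarith))).2
    rw [add_sub_cancel_left, div_one] at hslope
    linarith [hQ' ξ hTξ]
  -- In the constraint each of `1`, `Ψ²`, `2μG` is at most `1`, and `-2Ψκ` is negative.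
  have hp : 2 * r ξ ^ 2 * pTheta N (r ξ) (fun j => ω j ξ) ≤ 3 := by
    have h1 := h.two_mul_Ψ_mul_κ hξ0
    have h2 := h.Ψ_pos ξ hξ0
    have h3 := mul_pos h2 (one_pos.trans_le (hκ ξ hTξ))
    have h4 : Ψ ξ ≤ 1 := (hS ξ hSξ).2.1
    nlinarith
  have hω : ω j ξ ^ 2 ≤ B := by
    refine sq_le_of_sum_le (w := fun j => ω j ξ) (h.ω_zero ξ hξ0) ?_ hj
    rw [sum_eq_mul_pTheta (h.r_pos ξ hξ0)]
    have h1 : r ξ ^ 2 ≤ R ^ 2 := pow_le_pow_left₀ (h.r_pos ξ hξ0).le (hR ξ hξ0) 2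
    have h2 : 0 ≤ 2 * r ξ ^ 2 := by positivity
    calc 2 * r ξ ^ 2 * (2 * r ξ ^ 2 * pTheta N (r ξ) (fun j => ω j ξ))
        ≤ 2 * r ξ ^ 2 * 3 := mul_le_mul_of_nonneg_left hp h2
      _ ≤ 2 * R ^ 2 * 3 := by linarith
  have hω' : |ω j ξ| ≤ B + 1 := by
    rw [← sq_abs] at hω
    nlinarith [sq_nonneg (|ω j ξ| - 1)]
  have e1 := hm1 (mem_Ici.2 hTt) (mem_Ici.2 hTξ) hξ.1.le
  have e2 := hm2 (mem_Ici.2 hTt) (mem_Ici.2 hTξ) hξ.1.le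
  have e3 := (abs_le.1 (hdQ ξ hSξ)).2
  have e4 : R * (ξ + Q ξ / 2) - R * (t + Q t / 2) ≤ 2 * R := by
    have : ξ + Q ξ / 2 - (t + Q t / 2) ≤ 2 := by linarith [hξ.2]
    nlinarith
  simp only [Pi.add_apply, Pi.sub_apply] at e1 e2
  simp only [Pi.one_apply, norm_one, mul_one, Real.norm_eq_abs]
  rw [abs_le] at hω' ⊢
  constructor <;> linarith [hω'.1, hω'.2]

theorem isBigO_gaugeForce (h : IsGlobalSolution N r Ψ κ ω U)
    (hhor : HasRegularHorizon N rh r Ψ ω U) (hbdd : ∃ R : ℝ, ∀ τ : ℝ, 0 < τ → r τ ≤ R)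
    {j : ℕ} (hj : j ∈ Finset.Ico 1 N) :
    (fun τ => gaugeForce (fun i => ω i τ) j) =O[atTop] (1 : ℝ → ℝ) := by
  have hj' := Finset.mem_Ico.1 hj
  have hsq : ∀ i ≤ N, (fun τ => ω i τ ^ 2) =O[atTop] (1 : ℝ → ℝ) := fun i hi => by
    simpa only [sq] using isBigO_one_mul (h.isBigO_ω hhor hbdd hi) (h.isBigO_ω hhor hbdd hi)
  exact isBigO_one_mul (((isBigO_refl (1 : ℝ → ℝ) _).sub (hsq j hj'.2.le)).add
    (((hsq (j + 1) hj'.2).add (hsq (j - 1) (by omega))).const_mul_left (1 / 2)))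
    (h.isBigO_ω hhor hbdd hj'.2.le)

theorem isBigO_r_mul_U (h : IsGlobalSolution N r Ψ κ ω U)
    (hhor : HasRegularHorizon N rh r Ψ ω U) (hbdd : ∃ R : ℝ, ∀ τ : ℝ, 0 < τ → r τ ≤ R)
    {j : ℕ} (hj : j ∈ Finset.Ico 1 N) :
    (fun τ => r τ * U j τ) =O[atTop] (1 : ℝ → ℝ) := by
  have hc := (h.tendsto_κ hhor hbdd).sub ((h.tendsto_Ψ hhor hbdd).const_mul 2)
  refine isBigO_one_of_damped ((eventually_gt_atTop 0).mono fun t ht => h.hasDerivAt_r_mul_U hj ht)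
    (hc.eventually_const_le (by norm_num)) (h.isBigO_gaugeForce hhor hbdd hj).neg_left

theorem isBigO_U (h : IsGlobalSolution N r Ψ κ ω U)
    (hhor : HasRegularHorizon N rh r Ψ ω U) (hbdd : ∃ R : ℝ, ∀ τ : ℝ, 0 < τ → r τ ≤ R)
    {j : ℕ} (hj : j ∈ Finset.Ico 1 N) : U j =O[atTop] (1 : ℝ → ℝ) := by
  obtain ⟨ρ, hρ, hr⟩ := h.exists_tendsto_r hbdd
  refine (isBigO_one_mul ((hr.inv₀ hρ.ne').isBigO_one ℝ)
    (h.isBigO_r_mul_U hhor hbdd hj)).congr' ?_ EventuallyEq.rfl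
  filter_upwards [eventually_gt_atTop 0] with t ht
  exact inv_mul_cancel_left₀ (h.r_pos t ht).ne' _

/-! ### Decay of `μG` and of the gauge forces -/

/-- Barbalat's lemma for `Ψ → 0`, whose derivative is `-2μG` plus a term tending to zero. -/
theorem tendsto_muG (h : IsGlobalSolution N r Ψ κ ω U)
    (hhor : HasRegularHorizon N rh r Ψ ω U) (hbdd : ∃ R : ℝ, ∀ τ : ℝ, 0 < τ → r τ ≤ R) :
    Tendsto (fun τ => muG N (fun j => U j τ)) atTop (𝓝 0) := by
  obtain ⟨ρ, hρ, hr⟩ := h.exists_tendsto_r hbdd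
  have hΨ := h.tendsto_Ψ hhor hbdd
  have hκ := h.tendsto_κ hhor hbdd
  have hφ : Tendsto (fun t => (κ t - Ψ t) * Ψ t) atTop (𝓝 0) := by
    simpa using (hκ.sub hΨ).mul hΨ
  have hrinv : (fun t => 1 / r t) =O[atTop] (1 : ℝ → ℝ) :=
    (tendsto_const_nhds.div hr hρ.ne').isBigO_one ℝ
  have key : Tendsto (fun t => -2 * muG N (fun j => U j t)) atTop (𝓝 0) := by
    refine tendsto_zero_of_hasDerivAt_add (φ := fun t => (κ t - Ψ t) * Ψ t)
      (ψ' := fun t => -2 * ∑ j ∈ Finset.Ico 1 N, 2 * (U j t *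
        (-(κ t - Ψ t) * U j t - 1 / r t * gaugeForce (fun i => ω i t) j))) hΨ ?_ hφ ?_ ?_
    · filter_upwards [eventually_gt_atTop 0] with t ht
      exact (h.Ψ_deriv t ht).congr_deriv (by ring)
    · filter_upwards [eventually_gt_atTop 0] with t ht
      refine HasDerivAt.const_mul _ (HasDerivAt.fun_sum fun j hj => ?_)
      refine ((h.U_deriv j hj t ht).pow 2).congr_deriv ?_
      simp only [Nat.cast_ofNat, Nat.add_one_sub_one, pow_one]
      ring
    · refine IsBigO.const_mul_left (IsBigO.fun_sum fun j hj => IsBigO.const_mul_left ?_ _) _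
      have hU := h.isBigO_U hhor hbdd hj
      exact isBigO_one_mul hU ((isBigO_one_mul ((hκ.sub hΨ).neg.isBigO_one ℝ) hU).sub
        (isBigO_one_mul hrinv (h.isBigO_gaugeForce hhor hbdd hj)))
  have := key.const_mul (-1 / 2)
  rw [mul_zero] at this
  exact this.congr fun t => by ring

theorem tendsto_r_mul_U (h : IsGlobalSolution N r Ψ κ ω U)
    (hhor : HasRegularHorizon N rh r Ψ ω U) (hbdd : ∃ R : ℝ, ∀ τ : ℝ, 0 < τ → r τ ≤ R)
    {j : ℕ} (hj : j ∈ Finset.Ico 1 N) : Tendsto (fun τ => r τ * U j τ) atTop (𝓝 0) := by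
  obtain ⟨ρ, hρ, hr⟩ := h.exists_tendsto_r hbdd
  have hU : Tendsto (U j) atTop (𝓝 0) := by
    have h2 : Tendsto (fun t => U j t ^ 2) atTop (𝓝 0) :=
      squeeze_zero (fun _ => sq_nonneg _)
        (fun t => sq_le_muG (u := fun j => U j t) hj) (h.tendsto_muG hhor hbdd)
    have h3 := h2.sqrt
    simp only [Real.sqrt_sq_eq_abs, Real.sqrt_zero] at h3
    exact (tendsto_zero_iff_abs_tendsto_zero _).2 h3
  simpa using hr.mul hU

theorem exists_hasDerivAt_ω (h : IsGlobalSolution N r Ψ κ ω U)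
    (hhor : HasRegularHorizon N rh r Ψ ω U) (hbdd : ∃ R : ℝ, ∀ τ : ℝ, 0 < τ → r τ ≤ R)
    {j : ℕ} (hj : j ≤ N) :
    ∃ d : ℝ → ℝ, d =O[atTop] (1 : ℝ → ℝ) ∧ ∀ t, 0 < t → HasDerivAt (ω j) (d t) t := by
  rcases Nat.eq_zero_or_pos j with rfl | hj0
  · refine ⟨fun _ => 0, isBigO_zero _ _, fun t ht => (hasDerivAt_const t 0).congr_of_eventuallyEq ?_⟩
    filter_upwards [lt_mem_nhds ht] with s hs using h.ω_zero s hs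
  rcases hj.eq_or_lt with rfl | hjN
  · refine ⟨fun _ => 0, isBigO_zero _ _, fun t ht => (hasDerivAt_const t 0).congr_of_eventuallyEq ?_⟩
    filter_upwards [lt_mem_nhds ht] with s hs using h.ω_last s hs
  have hmem : j ∈ Finset.Ico 1 N := Finset.mem_Ico.2 ⟨hj0, hjN⟩
  exact ⟨_, h.isBigO_r_mul_U hhor hbdd hmem, h.ω_deriv j hmem⟩

/-- Barbalat's lemma for `r U_j → 0`, whose derivative is minus the force plus a vanishing damping
term. -/
theorem tendsto_gaugeForce (h : IsGlobalSolution N r Ψ κ ω U)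
    (hhor : HasRegularHorizon N rh r Ψ ω U) (hbdd : ∃ R : ℝ, ∀ τ : ℝ, 0 < τ → r τ ≤ R)
    {j : ℕ} (hj : j ∈ Finset.Ico 1 N) :
    Tendsto (fun τ => gaugeForce (fun i => ω i τ) j) atTop (𝓝 0) := by
  have hj' := Finset.mem_Ico.1 hj
  choose! d hdO hd using fun i (hi : i ≤ N) => h.exists_hasDerivAt_ω hhor hbdd hi
  have hO := fun i (hi : i ≤ N) => h.isBigO_ω hhor hbdd hi
  have hc := (h.tendsto_κ hhor hbdd).sub ((h.tendsto_Ψ hhor hbdd).const_mul 2)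
  have hrU := h.tendsto_r_mul_U hhor hbdd hj
  have hφ : Tendsto (fun t => -(κ t - 2 * Ψ t) * (r t * U j t)) atTop (𝓝 0) := by
    simpa using hc.neg.mul hrU
  have h1 : j - 1 ≤ N := by omega
  have h2 : j ≤ N := hj'.2.le
  have h3 : j + 1 ≤ N := hj'.2
  have hprod : ∀ i ≤ N, (fun t => 2 * (ω i t * d i t)) =O[atTop] (1 : ℝ → ℝ) := fun i hi =>
    (isBigO_one_mul (hO i hi) (hdO i hi)).const_mul_left 2
  have hsq : ∀ i ≤ N, (fun τ => ω i τ ^ 2) =O[atTop] (1 : ℝ → ℝ) := fun i hi => by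
    simpa only [sq] using isBigO_one_mul (hO i hi) (hO i hi)
  have hsqd : ∀ i ≤ N, ∀ t, 0 < t → HasDerivAt (fun t => ω i t ^ 2) (2 * (ω i t * d i t)) t :=
    fun i hi t ht => ((hd i hi t ht).pow 2).congr_deriv (by
      simp only [Nat.cast_ofNat, Nat.add_one_sub_one, pow_one]; ring)
  have key := tendsto_zero_of_hasDerivAt_add (ψ := fun t => -gaugeForce (fun i => ω i t) j) hrU
    ((eventually_gt_atTop 0).mono fun t ht => h.hasDerivAt_r_mul_U hj ht) hφ
    ((eventually_gt_atTop 0).mono fun t ht =>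
      (((((hsqd j h2 t ht).const_sub 1).add (((hsqd (j + 1) h3 t ht).add
        (hsqd (j - 1) h1 t ht)).const_mul (1 / 2))).mul (hd j h2 t ht))).neg)
    (((isBigO_one_mul ((hprod j h2).neg_left.add (((hprod (j + 1) h3).add
        (hprod (j - 1) h1)).const_mul_left (1 / 2))) (hO j h2)).add
      (isBigO_one_mul (((isBigO_refl (1 : ℝ → ℝ) _).sub (hsq j h2)).add
        (((hsq (j + 1) h3).add (hsq (j - 1) h1)).const_mul_left (1 / 2))) (hdO j h2))).neg_left)
  simpa using key.neg

end IsGlobalSolution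

/-! ### Fluxes, and a gauge function that tends to zero -/

/-- If the differences of consecutive fluxes `ω_j² - ω_{j-1}² - N - 1 + 2j` tend to zero, then so
do the fluxes themselves, because they add up to zero. -/
theorem tendsto_flux_of_tendsto_diff {a : ℕ → ℝ → ℝ} (hN : 1 ≤ N)
    (hd : ∀ j ∈ Finset.Ico 1 N, Tendsto (fun t => a (j + 1) t - a j t) atTop (𝓝 0))
    (hs : ∀ᶠ t in atTop, ∑ j ∈ Finset.Icc 1 N, a j t = 0) :
    ∀ j ∈ Finset.Icc 1 N, Tendsto (a j) atTop (𝓝 0) := by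
  have hdiff : ∀ j, 1 ≤ j → j ≤ N → Tendsto (fun t => a j t - a 1 t) atTop (𝓝 0) := by
    intro j hj
    induction j, hj using Nat.le_induction with
    | base => simp
    | succ k hk ih =>
      intro hkN
      have := (hd k (Finset.mem_Ico.2 ⟨hk, hkN⟩)).add (ih (by omega))
      simpa using this
  have h1 : Tendsto (a 1) atTop (𝓝 0) := by
    have hsum := (tendsto_finsetSum (Finset.Icc 1 N) fun j hj =>
      hdiff j (Finset.mem_Icc.1 hj).1 (Finset.mem_Icc.1 hj).2).const_mul (-(1 / (N : ℝ)))
    simp only [Finset.sum_const_zero, mul_zero] at hsum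
    refine hsum.congr' ?_
    filter_upwards [hs] with t ht
    have : (N : ℝ) ≠ 0 := by exact_mod_cast (by omega : N ≠ 0)
    rw [Finset.sum_sub_distrib, ht]
    simp only [Finset.sum_const, Nat.card_Icc, Nat.add_sub_cancel, nsmul_eq_mul]
    field_simp
    ring
  intro j hj
  have := (hdiff j (Finset.mem_Icc.1 hj).1 (Finset.mem_Icc.1 hj).2).add h1
  simpa using this

theorem sum_flux_eq_zero {w : ℕ → ℝ} (h0 : w 0 = 0) (hN : w N = 0) :
    ∑ j ∈ Finset.Icc 1 N, (w j ^ 2 - w (j - 1) ^ 2 - (N : ℝ) - 1 + 2 * (j : ℝ)) = 0 := by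
  have key : ∀ n : ℕ, ∑ j ∈ Finset.Icc 1 n, (w j ^ 2 - w (j - 1) ^ 2 - (N : ℝ) - 1 + 2 * (j : ℝ))
      = w n ^ 2 - w 0 ^ 2 + n * ((n : ℝ) - N) := by
    intro n
    induction n with
    | zero => simp
    | succ k ih =>
      rw [Finset.sum_Icc_succ_top (Nat.le_add_left 1 k), ih]
      simp only [Nat.add_sub_cancel]
      push_cast
      ring
  rw [key, h0, hN]
  ring

namespace IsGlobalSolution

theorem tendsto_pTheta (h : IsGlobalSolution N r Ψ κ ω U)
    (hhor : HasRegularHorizon N rh r Ψ ω U) (hbdd : ∃ R : ℝ, ∀ τ : ℝ, 0 < τ → r τ ≤ R) :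
    Tendsto (fun τ => 2 * r τ ^ 2 * pTheta N (r τ) (fun j => ω j τ)) atTop (𝓝 1) := by
  have hΨ := h.tendsto_Ψ hhor hbdd
  have := (((hΨ.pow 2).const_add 1).add ((h.tendsto_muG hhor hbdd).const_mul 2)).sub
    ((hΨ.mul (h.tendsto_κ hhor hbdd)).const_mul 2)
  norm_num at this
  refine this.congr' ?_
  filter_upwards [eventually_gt_atTop 0] with t ht
  rw [h.two_mul_Ψ_mul_κ ht]
  ring

/-- A gauge function either tends to zero or is eventually bounded away from zero. -/
theorem tendsto_ω_or_le_abs (h : IsGlobalSolution N r Ψ κ ω U)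
    (hhor : HasRegularHorizon N rh r Ψ ω U) (hbdd : ∃ R : ℝ, ∀ τ : ℝ, 0 < τ → r τ ≤ R)
    {j : ℕ} (hj : j ∈ Finset.Ico 1 N) :
    Tendsto (ω j) atTop (𝓝 0) ∨ ∀ᶠ t in atTop, 1 / 2 ≤ |ω j t| := by
  have hF := h.tendsto_gaugeForce hhor hbdd hj
  have hFa : ∀ᶠ t in atTop, |gaugeForce (fun i => ω i t) j| < 1 / 8 := by
    have := (Metric.tendsto_nhds.1 hF) (1 / 8) (by norm_num)
    simpa [Real.dist_eq] using this
  have hsmall : ∀ t, |ω j t| ≤ 1 / 2 → |ω j t| ≤ 4 / 3 * |gaugeForce (fun i => ω i t) j| := by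
    intro t ht
    have h1 : ω j t ^ 2 ≤ 1 / 4 := by
      rw [← sq_abs]; nlinarith [abs_nonneg (ω j t)]
    have h2 : 3 / 4 ≤ 1 - ω j t ^ 2 + 1 / 2 * (ω (j + 1) t ^ 2 + ω (j - 1) t ^ 2) := by
      nlinarith [sq_nonneg (ω (j + 1) t), sq_nonneg (ω (j - 1) t)]
    have h3 := h2.trans (le_abs_self _)
    unfold gaugeForce
    rw [abs_mul]
    nlinarith [abs_nonneg (ω j t)]
  obtain ⟨T, hT⟩ := eventually_atTop.1 (hFa.and (eventually_gt_atTop 0))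
  have hcont : ContinuousOn (fun t => |ω j t|) (Ici T) := fun t ht =>
    ((h.ω_deriv j hj t (hT t ht).2).continuousAt.abs).continuousWithinAt
  -- A force below `1/8` makes `|ω_j| ≤ 1/2` imply `|ω_j| < 1/6`, so by continuity `|ω_j|` stays on
  -- one side of `1/2`.
  have hgap : ∀ t ∈ Ici T, |ω j t| ≠ 1 / 2 := fun t ht he => by
    linarith [hsmall t he.le, (hT t ht).1]
  by_cases hall : ∀ t ∈ Ici T, 1 / 2 ≤ |ω j t|
  · exact Or.inr (eventually_atTop.2 ⟨T, hall⟩)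
  left
  push Not at hall
  obtain ⟨s, hs, hs2⟩ := hall
  have hlt : ∀ t ∈ Ici T, |ω j t| ≤ 1 / 2 := by
    intro t ht
    by_contra! hgt
    obtain ⟨x, hx, hx2⟩ := isPreconnected_Ici.intermediate_value hs ht hcont ⟨hs2.le, hgt.le⟩
    exact hgap x hx hx2
  have hF' := hF.abs.const_mul (4 / 3)
  rw [abs_zero, mul_zero] at hF'
  refine squeeze_zero_norm' ?_ hF'
  filter_upwards [eventually_ge_atTop T] with t ht using hsmall t (hlt t ht)

theorem exists_tendsto_ω (h : IsGlobalSolution N r Ψ κ ω U) (hN : 1 ≤ N)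
    (hhor : HasRegularHorizon N rh r Ψ ω U) (hbdd : ∃ R : ℝ, ∀ τ : ℝ, 0 < τ → r τ ≤ R) :
    ∃ j ∈ Finset.Ico 1 N, Tendsto (ω j) atTop (𝓝 0) := by
  by_contra! hcon
  obtain ⟨ρ, hρ, hr⟩ := h.exists_tendsto_r hbdd
  have hlow : ∀ j ∈ Finset.Ico 1 N, ∀ᶠ t in atTop, 1 / 2 ≤ |ω j t| := fun j hj =>
    (h.tendsto_ω_or_le_abs hhor hbdd hj).resolve_left (hcon j hj)
  have hd : ∀ j ∈ Finset.Ico 1 N, Tendsto (fun t =>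
      (ω (j + 1) t ^ 2 - ω (j + 1 - 1) t ^ 2 - (N : ℝ) - 1 + 2 * ((j + 1 : ℕ) : ℝ))
        - (ω j t ^ 2 - ω (j - 1) t ^ 2 - (N : ℝ) - 1 + 2 * (j : ℝ))) atTop (𝓝 0) := by
    intro j hj
    have hF := (h.tendsto_gaugeForce hhor hbdd hj).abs.const_mul 4
    rw [abs_zero, mul_zero] at hF
    refine squeeze_zero_norm' ?_ hF
    filter_upwards [hlow j hj] with t ht
    -- The flux difference is twice the bracket of the force; `|ω_j| ≥ 1/2` bounds it by four times
    -- the force.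
    have e : (ω (j + 1) t ^ 2 - ω (j + 1 - 1) t ^ 2 - (N : ℝ) - 1 + 2 * ((j + 1 : ℕ) : ℝ))
        - (ω j t ^ 2 - ω (j - 1) t ^ 2 - (N : ℝ) - 1 + 2 * (j : ℝ))
        = 2 * (1 - ω j t ^ 2 + 1 / 2 * (ω (j + 1) t ^ 2 + ω (j - 1) t ^ 2)) := by
      simp only [Nat.add_sub_cancel]
      push_cast
      ring
    rw [e, Real.norm_eq_abs]
    unfold gaugeForce
    rw [abs_mul, abs_mul, abs_two]
    nlinarith [abs_nonneg (1 - ω j t ^ 2 + 1 / 2 * (ω (j + 1) t ^ 2 + ω (j - 1) t ^ 2))]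
  have hflux := tendsto_flux_of_tendsto_diff
    (a := fun j t => ω j t ^ 2 - ω (j - 1) t ^ 2 - (N : ℝ) - 1 + 2 * (j : ℝ)) hN hd (by
      filter_upwards [eventually_gt_atTop 0] with t ht
      exact sum_flux_eq_zero (w := fun j => ω j t) (h.ω_zero t ht) (h.ω_last t ht))
  have hsum := tendsto_finsetSum (Finset.Icc 1 N) fun j hj => (hflux j hj).pow 2
  have hlim := (((hr.pow 2).const_mul 2).mul (h.tendsto_pTheta hhor hbdd))
  have h0 := tendsto_nhds_unique (hsum.congr' (by
    filter_upwards [eventually_gt_atTop 0] with t ht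
    exact sum_eq_mul_pTheta (h.r_pos t ht) (fun j => ω j t))) hlim
  simp at h0
  exact hρ.ne' h0

/-! ### Oscillation -/

/-- A gauge function which tends to zero oscillates about zero. -/
theorem exists_ω_eq_zero (h : IsGlobalSolution N r Ψ κ ω U)
    (hhor : HasRegularHorizon N rh r Ψ ω U) (hbdd : ∃ R : ℝ, ∀ τ : ℝ, 0 < τ → r τ ≤ R)
    {j : ℕ} (hj : j ∈ Finset.Ico 1 N) (hω : Tendsto (ω j) atTop (𝓝 0)) {T : ℝ} (hT : 0 < T) :
    ∃ t, T ≤ t ∧ ω j t = 0 := by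
  by_contra! hne
  have hc : Tendsto (fun t => κ t - 2 * Ψ t) atTop (𝓝 1) := by
    simpa using (h.tendsto_κ hhor hbdd).sub ((h.tendsto_Ψ hhor hbdd).const_mul 2)
  have hω2 : Tendsto (fun t => ω j t ^ 2) atTop (𝓝 0) := by simpa using hω.pow 2
  obtain ⟨S, hS⟩ := eventually_atTop.1 ((eventually_ge_atTop T).and
    ((hc.eventually_const_le (by norm_num : (0 : ℝ) < 1)).and
    ((hc.eventually_le_const (by norm_num : (1 : ℝ) < 11 / 10)).and
      (hω2.eventually_le_const (by norm_num : (0 : ℝ) < 1 / 4)))))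
  have hmono := monotoneOn_Ici_of_hasDerivAt_nonneg
    (f := fun t => -Real.arctan (r t * U j t / ω j t) - t / 4) (a := S)
    (fun t ht => by
      have hTt := (hS t ht).1
      have ht0 := hT.trans_le hTt
      exact (((h.hasDerivAt_r_mul_U hj ht0).div (h.ω_deriv j hj t ht0)
        (hne t hTt)).arctan.neg).sub ((hasDerivAt_id t).div_const 4))
    fun t ht => by
      obtain ⟨hTt, hc1, hc2, hw⟩ := hS t ht
      have hw0 := hne t hTt
      set v := r t * U j t / ω j t with hv
      have hrU : r t * U j t = v * ω j t := by rw [hv, div_mul_cancel₀ _ hw0]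
      set c := 1 - ω j t ^ 2 + 1 / 2 * (ω (j + 1) t ^ 2 + ω (j - 1) t ^ 2) with hcdef
      have hF : gaugeForce (fun i => ω i t) j = c * ω j t := rfl
      have hc3 : 3 / 4 ≤ c := by
        nlinarith [sq_nonneg (ω (j + 1) t), sq_nonneg (ω (j - 1) t)]
      have e : ((-(κ t - 2 * Ψ t) * (r t * U j t) + -gaugeForce (fun i => ω i t) j) * ω j t -
          r t * U j t * (r t * U j t)) / ω j t ^ 2 = -(v ^ 2 + (κ t - 2 * Ψ t) * v + c) := by
        rw [hF, hrU]
        field_simp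
        ring
      simp only [Pi.div_apply, ← hv]
      rw [e]
      set b := κ t - 2 * Ψ t
      have hb : b ^ 2 ≤ 5 / 4 := by nlinarith
      have hpos : 0 < 1 + v ^ 2 := by positivity
      -- With `c ≥ 3/4` it suffices that `3v²/4 + bv + 1/2 ≥ 0`, which holds as `b² ≤ 3/2`.
      have : 1 / 4 ≤ 1 / (1 + v ^ 2) * (v ^ 2 + b * v + c) := by
        rw [one_div_mul_eq_div, le_div_iff₀ hpos]
        nlinarith [sq_nonneg (3 * v + 2 * b)]
      linarith
  -- At rate `1/4`, time `4π` costs the arctangent at least `π`, the full width of its open range.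
  have h1 := hmono (mem_Ici.2 le_rfl) (mem_Ici.2 (by linarith [Real.pi_pos] : S ≤ S + 4 * Real.pi))
    (by linarith [Real.pi_pos])
  simp only at h1
  linarith [Real.neg_pi_div_two_lt_arctan (r (S + 4 * Real.pi) * U j (S + 4 * Real.pi) /
    ω j (S + 4 * Real.pi)), Real.arctan_lt_pi_div_two (r S * U j S / ω j S)]

end IsGlobalSolution

end SuNEYM

theorem proposition5 (N : ℕ) (hN : 2 ≤ N) (rh : ℝ) (r Ψ κ : ℝ → ℝ) (ω U : ℕ → ℝ → ℝ)
    (hsol : SuNEYM.IsGlobalSolution N r Ψ κ ω U)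
    (hhor : SuNEYM.HasRegularHorizon N rh r Ψ ω U)
    (hbdd : ∃ R : ℝ, ∀ τ : ℝ, 0 < τ → r τ ≤ R) :
    Tendsto Ψ atTop (𝓝 0) ∧
    Tendsto κ atTop (𝓝 1) ∧
    (∃ j ∈ Finset.Ico 1 N, Tendsto (ω j) atTop (𝓝 0)) ∧
    (∀ j ∈ Finset.Ico 1 N, Tendsto (ω j) atTop (𝓝 0) →
      {τ : ℝ | 0 < τ ∧ ω j τ = 0}.Infinite) :=
  ⟨hsol.tendsto_Ψ hhor hbdd, hsol.tendsto_κ hhor hbdd,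
    hsol.exists_tendsto_ω (one_le_two.trans hN) hhor hbdd, fun _ hj hω =>
    SuNEYM.zeros_infinite_of_frequently fun _ hT => hsol.exists_ω_eq_zero hhor hbdd hj hω hT⟩
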